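/- A \emph{Cantor set} is a zero-dimensional compact metric space without isolated points. A \emph{minimal Cantor system} $(C,T)$ consists of a Cantor set $C$ and a continuous map $T\colon C\to C$, not necessarily invertible, such that for every $x\in C$ the orbit $\{T^n(x):n\ge 0\}$ is dense in $C$. \textbf{Theorem.} Let $(C,T)$ be a minimal Cantor system. Then there exists a topological embedding $\pi\colon C\to\mathbb{R}$ such that the map $f=\pi\circ T\circ\pi^{-1}\colon \pi(C)\to\pi(C)$ has derivative $0$ everywhere, i.e. for every $x\in\pi(C)$, $$\lim_{\substack{y\to x\\ y\in\pi(C)\setminus\{x\}}}\frac{f(y)-f(x)}{y-x}=0 .$$ -/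

import Mathlib

/-- `(C, T)` is a minimal dynamical system: `T` is a continuous self-map of `C` (not assumed to be
invertible) and every (forward) orbit `{x, T x, T (T x), …}` is dense in `C`. -/
structure IsMinimalSystem {C : Type*} [TopologicalSpace C] (T : C → C) : Prop where
  continuous : Continuous T
  dense_orbit : ∀ x : C, Dense (Set.range fun n : ℕ => T^[n] x)

/-! Choose pairwise disjoint nonempty clopen sets `U n`; by minimality every orbit enters each. The
code `e (n + 1)` records the level-`n` data along the orbit until `U n` is reached, and the height
`r (n + 1)` is the time this takes. If `x ∉ U n`, applying `T` deletes the head of the itinerary, so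
the new code is determined by the old one and the height drops by one. Disjointness makes this hold
at all large levels. Put `π x = ∑ ε n * D n ^ r n x * e (n + 1) x` with `ε` decaying fast. If the
codes of `x` and `y` first differ at level `n + 1`, then `|π x - π y|` is at least half of `w n x =
ε n * D n ^ r n x`. The images still agree at level `n` and have smaller height, which costs a
factor `D n`, so the difference quotient is at most `4 / (n + 1)`. -/

open Topology Filter

/-! ### Entrance times and itineraries -/

section Entrance

variable {C : Type*} {T : C → C} {U : Set C}

/-- The first time at which the orbit of `x` under `T` visits `U`. -/
noncomputable def entranceTime (T : C → C) (U : Set C) (x : C) : ℕ :=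
  sInf {j | T^[j] x ∈ U}

theorem iterate_entranceTime_mem (hU : ∀ x, ∃ j, T^[j] x ∈ U) (x : C) :
    T^[entranceTime T U x] x ∈ U :=
  Nat.sInf_mem (s := {j | T^[j] x ∈ U}) (hU x)

theorem entranceTime_eq {x : C} {n : ℕ} (hn : T^[n] x ∈ U) (h : ∀ j < n, T^[j] x ∉ U) :
    entranceTime T U x = n := by
  refine le_antisymm (Nat.sInf_le hn) ?_
  by_contra! hlt
  exact h _ hlt (Nat.sInf_mem (s := {j | T^[j] x ∈ U}) ⟨n, hn⟩)

theorem entranceTime_eq_succ (hU : ∀ x, ∃ j, T^[j] x ∈ U) {x : C} (hx : x ∉ U) :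
    entranceTime T U x = entranceTime T U (T x) + 1 := by
  refine entranceTime_eq (iterate_entranceTime_mem hU (T x)) fun j hj => ?_
  cases j with
  | zero => exact hx
  | succ j =>
    exact Nat.notMem_of_lt_sInf (s := {j | T^[j] (T x) ∈ U}) (Nat.succ_lt_succ_iff.1 hj)

theorem isLocallyConstant_entranceTime [TopologicalSpace C] (hT : Continuous T)
    (hUc : IsClopen U) (hU : ∀ x, ∃ j, T^[j] x ∈ U) :
    IsLocallyConstant (entranceTime T U) := by
  rw [IsLocallyConstant.iff_eventually_eq]
  intro x
  have h1 : ∀ᶠ y in 𝓝 x, T^[entranceTime T U x] y ∈ U :=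
    (hT.iterate _).continuousAt.eventually
      (hUc.isOpen.eventually_mem (iterate_entranceTime_mem hU x))
  have h2 : ∀ᶠ y in 𝓝 x, ∀ j ∈ Finset.range (entranceTime T U x), T^[j] y ∉ U := by
    rw [Filter.eventually_all_finset]
    intro j hj
    exact (hT.iterate j).continuousAt.eventually
      (hUc.compl.isOpen.eventually_mem (Nat.notMem_of_lt_sInf (Finset.mem_range.1 hj)))
  filter_upwards [h1, h2] with y hy1 hy2
  exact entranceTime_eq hy1 fun j hj => hy2 j (Finset.mem_range.2 hj)

/-- The values of `g` along the orbit of `x` up to the first visit to `U`. -/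
noncomputable def itinerary (T : C → C) (U : Set C) (g : C → ℕ) (x : C) : List ℕ :=
  (List.range (entranceTime T U x + 1)).map fun j => g (T^[j] x)

theorem isLocallyConstant_itinerary [TopologicalSpace C] (hT : Continuous T)
    (hUc : IsClopen U) (hU : ∀ x, ∃ j, T^[j] x ∈ U) {g : C → ℕ} (hg : IsLocallyConstant g) :
    IsLocallyConstant (itinerary T U g) := by
  rw [IsLocallyConstant.iff_eventually_eq]
  intro x
  have h2 : ∀ᶠ y in 𝓝 x, ∀ j ∈ Finset.range (entranceTime T U x + 1),
      g (T^[j] y) = g (T^[j] x) := by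
    rw [Filter.eventually_all_finset]
    intro j _
    exact (hg.comp_continuous (hT.iterate j)).eventually_eq x
  filter_upwards [(isLocallyConstant_entranceTime hT hUc hU).eventually_eq x, h2] with y hy1 hy2
  rw [itinerary, itinerary, hy1]
  exact List.map_congr_left fun j hj => hy2 j (Finset.mem_range.2 (List.mem_range.1 hj))

theorem entranceTime_eq_of_itinerary_eq {g : C → ℕ} {x y : C}
    (h : itinerary T U g x = itinerary T U g y) : entranceTime T U x = entranceTime T U y := by
  simpa [itinerary] using congrArg List.length h

theorem apply_eq_of_itinerary_eq {g : C → ℕ} {x y : C}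
    (h : itinerary T U g x = itinerary T U g y) : g x = g y := by
  simpa [itinerary, List.range_succ_eq_map] using congrArg List.head? h

theorem itinerary_eq_cons (hU : ∀ x, ∃ j, T^[j] x ∈ U) (g : C → ℕ) {x : C} (hx : x ∉ U) :
    itinerary T U g x = g x :: itinerary T U g (T x) := by
  rw [itinerary, entranceTime_eq_succ hU hx, List.range_succ_eq_map, itinerary]
  simp

end Entrance

/-! ### Nested codes of a minimal system -/

section Codes

variable {C : Type*}

/-- Nested itinerary codes: the code at level `n + 1` is the itinerary until the first visit
to `U n`, read with respect to the code at level `n` and the function `q n`. -/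
noncomputable def itineraryCode (T : C → C) (U : ℕ → Set C) (q : ℕ → C → ℕ) : ℕ → C → ℕ
  | 0 => fun _ => 0
  | n + 1 => fun x => Encodable.encode
      (itinerary T (U n) (fun y => Nat.pair (itineraryCode T U q n y) (q n y)) x)

theorem exists_pairwise_disjoint_isClopen [TopologicalSpace C] [CompactSpace C] [T2Space C]
    [TotallyDisconnectedSpace C] [Infinite C] :
    ∃ U : ℕ → Set C, (∀ n, (U n).Nonempty) ∧ (∀ n, IsClopen (U n)) ∧
      Pairwise (Function.onFun Disjoint U) := by
  obtain ⟨V, hVi, hVo, hV⟩ := exists_seq_infinite_isOpen_pairwise_disjoint C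
  choose x hx using fun n => (hVi n).nonempty
  choose U hUc hxU hUV using fun n => compact_exists_isClopen_in_isOpen (hVo n) (hx n)
  exact ⟨U, fun n => ⟨x n, hxU n⟩, hUc, fun m n hmn => (hV hmn).mono (hUV m) (hUV n)⟩

theorem exists_isLocallyConstant_separating [TopologicalSpace C] [CompactSpace C] [T2Space C]
    [TotallyDisconnectedSpace C] [SecondCountableTopology C] :
    ∃ q : ℕ → C → ℕ, (∀ n, IsLocallyConstant (q n)) ∧ ∀ x y, x ≠ y → ∃ n, q n x ≠ q n y := by
  classical
  have : Countable (TopologicalSpace.Clopens C) :=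
    TopologicalSpace.Clopens.countable_iff_secondCountable.2 inferInstance
  obtain ⟨s, hs⟩ := exists_surjective_nat (TopologicalSpace.Clopens C)
  refine ⟨fun n => (s n : Set C).indicator 1, fun n => ?_, fun x y hxy => ?_⟩
  · exact (IsLocallyConstant.iff_continuous _).2
      (continuous_const.indicator (by simp [(s n).isClopen.frontier_eq]))
  · obtain ⟨V, hV, hx, hy⟩ := exists_isClopen_of_totally_separated hxy
    obtain ⟨n, hn⟩ := hs ⟨V, hV⟩
    refine ⟨n, ?_⟩
    have hy' : y ∉ V := hy
    simp [hn, hx, hy']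

/-- A minimal Cantor system has a separating sequence of nested finite codes `e n` and heights
`r n` such that, along each point, eventually `T` respects the code and lowers the height. -/
theorem IsMinimalSystem.exists_codes [TopologicalSpace C] [CompactSpace C] [T2Space C]
    [TotallyDisconnectedSpace C] [SecondCountableTopology C] [Infinite C]
    {T : C → C} (hT : IsMinimalSystem T) :
    ∃ e r : ℕ → C → ℕ, (∀ n, IsLocallyConstant (e n)) ∧ (∀ n, IsLocallyConstant (r n)) ∧
      (∀ x, e 0 x = 0) ∧ (∀ n x y, e (n + 1) x = e (n + 1) y → e n x = e n y) ∧
      (∀ n x y, e n x = e n y → r n x = r n y) ∧ (∀ x y, x ≠ y → ∃ n, e n x ≠ e n y) ∧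
      ∀ x, ∀ᶠ n in atTop, r n x = r n (T x) + 1 ∧
        ∀ y, e n x = e n y → e n (T x) = e n (T y) := by
  obtain ⟨U, hUn, hUc, hUd⟩ := exists_pairwise_disjoint_isClopen (C := C)
  obtain ⟨q, hq, hsep⟩ := exists_isLocallyConstant_separating (C := C)
  have hU : ∀ n x, ∃ j, T^[j] x ∈ U n := by
    intro n x
    obtain ⟨_, hz, j, rfl⟩ := (hT.dense_orbit x).inter_open_nonempty (U n) (hUc n).isOpen (hUn n)
    exact ⟨j, hz⟩
  have hcode : ∀ n x y, itineraryCode T U q (n + 1) x = itineraryCode T U q (n + 1) y →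
      itinerary T (U n) (fun y => Nat.pair (itineraryCode T U q n y) (q n y)) x =
        itinerary T (U n) (fun y => Nat.pair (itineraryCode T U q n y) (q n y)) y :=
    fun n x y h => Encodable.encode_injective h
  have hpair : ∀ n x y, itineraryCode T U q (n + 1) x = itineraryCode T U q (n + 1) y →
      itineraryCode T U q n x = itineraryCode T U q n y ∧ q n x = q n y := by
    intro n x y h
    have h1 := apply_eq_of_itinerary_eq (hcode n x y h)
    exact Nat.pair_eq_pair.1 h1
  refine ⟨itineraryCode T U q, fun n => n.casesOn 0 fun n => entranceTime T (U n), fun n => ?_,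
    fun n => ?_, fun x => rfl, fun n x y h => ?_, fun n x y h => ?_, fun x y hxy => ?_,
    fun x => ?_⟩
  · induction n with
    | zero => exact IsLocallyConstant.const 0
    | succ n ih =>
      exact (isLocallyConstant_itinerary hT.continuous (hUc n) (hU n)
        (ih.comp₂ (hq n) Nat.pair)).comp Encodable.encode
  · cases n with
    | zero => exact IsLocallyConstant.const 0
    | succ n => exact isLocallyConstant_entranceTime hT.continuous (hUc n) (hU n)
  · exact (hpair n x y h).1
  · cases n with
    | zero => rfl
    | succ n => exact entranceTime_eq_of_itinerary_eq (hcode n x y h)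
  · obtain ⟨n, hn⟩ := hsep x y hxy
    exact ⟨n + 1, fun h => hn (hpair n x y h).2⟩
  -- By disjointness `x` lies in at most one `U m`.
  · have hev : ∀ᶠ n in atTop, x ∉ U n := by
      by_cases h : ∃ m, x ∈ U m
      · obtain ⟨m, hm⟩ := h
        filter_upwards [eventually_gt_atTop m] with n hn hxn
        exact Set.disjoint_left.1 (hUd hn.ne) hm hxn
      · push Not at h
        exact Eventually.of_forall h
    rw [eventually_atTop] at hev ⊢
    obtain ⟨N, hN⟩ := hev
    refine ⟨N + 1, fun n hn => ?_⟩
    obtain ⟨n, rfl⟩ := Nat.exists_eq_add_of_le' (Nat.one_le_of_lt hn)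
    have hx : x ∉ U n := hN n (by omega)
    refine ⟨entranceTime_eq_succ (hU n) hx, fun y h => ?_⟩
    have h' := hcode n x y h
    have hr := entranceTime_eq_of_itinerary_eq h'
    -- Equal codes give equal entrance times, and that of `x` is positive.
    have hy : y ∉ U n := by
      intro hy
      rw [entranceTime_eq_succ (hU n) hx, entranceTime_eq (n := 0) hy (by simp)] at hr
      omega
    rw [itinerary_eq_cons (hU n) _ hx, itinerary_eq_cons (hU n) _ hy] at h'
    exact congrArg Encodable.encode (List.cons.inj h').2

end Codes

/-! ### From codes to an embedding in the line -/

section Embedding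

theorem exists_pos_fast_decay (K : ℕ → ℝ) (hK : ∀ n, 1 ≤ K n) :
    ∃ ε : ℕ → ℝ, (∀ n, 0 < ε n) ∧
      ∀ n i, ε (n + 1 + i) * K (n + 1 + i) ≤ ε n / (n + 2) / 2 / 2 ^ i := by
  let ε : ℕ → ℝ := fun n => n.rec 1 fun n x => x / (2 * (n + 2) * K (n + 1))
  have hK0 : ∀ n, 0 < K n := fun n => one_pos.trans_le (hK n)
  have hsucc : ∀ n, ε (n + 1) = ε n / (2 * (n + 2) * K (n + 1)) := fun n => rfl
  have hpos : ∀ n, 0 < ε n := by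
    intro n
    induction n with
    | zero => exact one_pos
    | succ n ih =>
      have := hK0 (n + 1)
      rw [hsucc]
      positivity
  have hhalf : ∀ n i, ε (n + i) ≤ ε n * (1 / 2) ^ i := by
    intro n i
    induction i with
    | zero => simp
    | succ i ih =>
      have h2 : (2 : ℝ) ≤ 2 * ((n + i : ℕ) + 2) * K (n + i + 1) := by
        have h3 : (1 : ℝ) ≤ (n + i : ℕ) + 2 := by
          have : (0 : ℝ) ≤ (n + i : ℕ) := Nat.cast_nonneg _
          linarith
        nlinarith [hK (n + i + 1), mul_le_mul h3 (hK (n + i + 1)) zero_le_one (by linarith)]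
      calc ε (n + (i + 1)) = ε (n + i) / (2 * ((n + i : ℕ) + 2) * K (n + i + 1)) := hsucc (n + i)
        _ ≤ ε (n + i) / 2 := div_le_div_of_nonneg_left (hpos _).le two_pos h2
        _ ≤ ε n * (1 / 2) ^ i / 2 := by gcongr
        _ = ε n * (1 / 2) ^ (i + 1) := by ring
  refine ⟨ε, hpos, fun n i => ?_⟩
  have hidx : n + 1 + i = n + i + 1 := by omega
  have hne := (hK0 (n + i + 1)).ne'
  rw [hidx]
  calc ε (n + i + 1) * K (n + i + 1) = ε (n + i) / (2 * ((n + i : ℕ) + 2)) := by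
        rw [hsucc]; field_simp
    _ ≤ ε n * (1 / 2) ^ i / (2 * (n + 2)) := by
        have := hpos n
        have h1 := hhalf n i
        gcongr
        simp
    _ = ε n / (n + 2) / 2 / 2 ^ i := by rw [one_div, inv_pow]; field_simp

variable {C : Type*}

theorem eq_of_eq_of_le {e : ℕ → C → ℕ} (hmono : ∀ n x y, e (n + 1) x = e (n + 1) y → e n x = e n y)
    {m n : ℕ} (hmn : m ≤ n) {x y : C} (h : e n x = e n y) : e m x = e m y := by
  induction n, hmn using Nat.le_induction with
  | base => exact h
  | succ n _ ih => exact ih (hmono n x y h)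

theorem IsLocallyConstant.exists_forall_le [TopologicalSpace C] [CompactSpace C] {g : C → ℕ}
    (hg : IsLocallyConstant g) : ∃ k, ∀ x, g x ≤ k := by
  obtain ⟨k, hk⟩ := hg.range_finite.bddAbove
  exact ⟨k, fun x => hk ⟨x, rfl⟩⟩

/-- Terms before `n` cancel; the tail is dominated by a geometric series with sum `δ`. -/
theorem abs_tsum_sub_tsum_sub_le {s t b : ℕ → ℝ} {δ : ℝ} {n : ℕ} (hb : Summable b)
    (hs0 : ∀ m, 0 ≤ s m) (hsb : ∀ m, s m ≤ b m) (ht0 : ∀ m, 0 ≤ t m) (htb : ∀ m, t m ≤ b m)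
    (hst : ∀ m < n, s m = t m) (hδ : ∀ i, b (n + 1 + i) ≤ δ / 2 / 2 ^ i) :
    |(∑' m, s m) - (∑' m, t m) - (s n - t n)| ≤ δ := by
  have hs : Summable s := hb.of_nonneg_of_le hs0 hsb
  have ht : Summable t := hb.of_nonneg_of_le ht0 htb
  have hs' : Summable fun i => s (i + (n + 1)) := (summable_nat_add_iff (n + 1)).2 hs
  have ht' : Summable fun i => t (i + (n + 1)) := (summable_nat_add_iff (n + 1)).2 ht
  have heq : (∑' m, s m) - (∑' m, t m) - (s n - t n) =
      ∑' i, (s (i + (n + 1)) - t (i + (n + 1))) := by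
    rw [← hs.sum_add_tsum_nat_add (n + 1), ← ht.sum_add_tsum_nat_add (n + 1),
      hs'.tsum_sub ht', Finset.sum_range_succ, Finset.sum_range_succ,
      Finset.sum_congr rfl fun m hm => hst m (Finset.mem_range.1 hm)]
    ring
  rw [heq, ← Real.norm_eq_abs]
  refine tsum_of_norm_bounded (hasSum_geometric_two' δ) fun i => ?_
  rw [Real.norm_eq_abs, add_comm i]
  refine (abs_le.2 ⟨?_, ?_⟩).trans (hδ i) <;>
    linarith [hs0 (n + 1 + i), ht0 (n + 1 + i), hsb (n + 1 + i), htb (n + 1 + i)]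

/-- A sequence of nested codes yields a map to `ℝ` whose increments are controlled by
weights `w n`, which grow rapidly with the height `r n`. -/
theorem exists_continuous_of_codes [TopologicalSpace C] [CompactSpace C] {e r : ℕ → C → ℕ}
    (he : ∀ n, IsLocallyConstant (e n)) (hr : ∀ n, IsLocallyConstant (r n))
    (hmono : ∀ n x y, e (n + 1) x = e (n + 1) y → e n x = e n y)
    (her : ∀ n x y, e n x = e n y → r n x = r n y) :
    ∃ (π : C → ℝ) (w : ℕ → C → ℝ), Continuous π ∧ (∀ n x, 0 < w n x) ∧
      (∀ n x y, e n x = e n y → e (n + 1) x ≠ e (n + 1) y → w n x / 2 ≤ |π x - π y|) ∧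
      ∀ n x x' y', r n x = r n x' + 1 → e n x' = e n y' →
        |π x' - π y'| ≤ 2 / (n + 1) * w n x := by
  choose k hk using fun n => (he (n + 1)).exists_forall_le
  choose R hR using fun n => (hr n).exists_forall_le
  -- One factor `D n` absorbs the range of `e (n + 1)` and still gains `1 / (n + 1)`.
  obtain ⟨D, hDdef⟩ : ∃ D : ℕ → ℝ, ∀ n, D n = (n + 1) * (k n + 1) := ⟨_, fun _ => rfl⟩
  have hD : ∀ n, 1 ≤ D n := fun n => by
    have h1 : (0 : ℝ) ≤ n := n.cast_nonneg
    have h2 : (0 : ℝ) ≤ k n := (k n).cast_nonneg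
    rw [hDdef]
    exact one_le_mul_of_one_le_of_one_le (by linarith) (by linarith)
  have hD0 : ∀ n, 0 < D n := fun n => one_pos.trans_le (hD n)
  obtain ⟨ε, hε, hdecay⟩ := exists_pos_fast_decay (fun n => D n ^ R n * (k n + 1)) fun n =>
    one_le_mul_of_one_le_of_one_le (one_le_pow₀ (hD n)) (by simp)
  obtain ⟨w, hwdef⟩ : ∃ w : ℕ → C → ℝ, ∀ n x, w n x = ε n * D n ^ r n x := ⟨_, fun _ _ => rfl⟩
  have hw : ∀ n x, 0 < w n x := fun n x => by
    rw [hwdef]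
    exact mul_pos (hε n) (pow_pos (hD0 n) _)
  have hεw : ∀ n x, ε n ≤ w n x := fun n x => by
    rw [hwdef]
    exact le_mul_of_one_le_right (hε n).le (one_le_pow₀ (hD n))
  obtain ⟨a, ha⟩ : ∃ a : ℕ → C → ℝ, ∀ n x, a n x = w n x * e (n + 1) x := ⟨_, fun _ _ => rfl⟩
  have ha0 : ∀ n x, 0 ≤ a n x := fun n x => by
    rw [ha]
    exact mul_nonneg (hw n x).le (Nat.cast_nonneg _)
  have haK : ∀ n x, a n x ≤ ε n * (D n ^ R n * (k n + 1)) := by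
    intro n x
    have h1 : (e (n + 1) x : ℝ) ≤ k n + 1 := by
      have : (e (n + 1) x : ℝ) ≤ k n := by exact_mod_cast hk n x
      linarith
    calc a n x = ε n * (D n ^ r n x * e (n + 1) x) := by rw [ha, hwdef]; ring
      _ ≤ ε n * (D n ^ R n * (k n + 1)) := by
        have := hε n
        have := hD n
        have := hD0 n
        have := hR n x
        gcongr
  have hbsum : Summable fun n => ε n * (D n ^ R n * (k n + 1)) := by
    refine (summable_nat_add_iff 1).1 ?_
    refine Summable.of_nonneg_of_le (fun n => ?_) (fun n => ?_)
      (hasSum_geometric_two' (ε 0 / ((0 : ℕ) + 2))).summable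
    · exact mul_nonneg (hε _).le (mul_nonneg (pow_nonneg (hD0 _).le _) (by positivity))
    · have := hdecay 0 n
      rwa [zero_add, add_comm 1 n] at this
  have hacont : ∀ n, Continuous (a n) := by
    intro n
    have h := ((hr n).comp₂ (he (n + 1)) fun p m => ε n * D n ^ p * (m : ℝ)).continuous
    refine h.congr fun x => ?_
    rw [ha, hwdef]
  have hmain : ∀ n x y, e n x = e n y →
      |(∑' m, a m x) - (∑' m, a m y) - w n x * ((e (n + 1) x : ℝ) - e (n + 1) y)| ≤
        ε n / (n + 2) := by
    intro n x y h
    have hwn : w n x = w n y := by rw [hwdef, hwdef, her n x y h]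
    have heq : w n x * ((e (n + 1) x : ℝ) - e (n + 1) y) = a n x - a n y := by
      rw [mul_sub, ha, ha, ← hwn]
    rw [heq]
    refine abs_tsum_sub_tsum_sub_le hbsum (fun m => ha0 m x) (fun m => haK m x) (fun m => ha0 m y)
      (fun m => haK m y) (fun m hm => ?_) (hdecay n)
    rw [ha, ha, hwdef, hwdef, her m x y (eq_of_eq_of_le hmono hm.le h),
      eq_of_eq_of_le hmono hm h]
  refine ⟨fun x => ∑' n, a n x, w, ?_, hw, fun n x y h hne => ?_, fun n x x' y' hrx h => ?_⟩
  · refine continuous_tsum hacont hbsum fun n x => ?_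
    rw [Real.norm_eq_abs, abs_of_nonneg (ha0 n x)]
    exact haK n x
  · have h1 : (1 : ℝ) ≤ |(e (n + 1) x : ℝ) - e (n + 1) y| := by
      have : (1 : ℤ) ≤ |(e (n + 1) x : ℤ) - e (n + 1) y| :=
        Int.one_le_abs (sub_ne_zero.2 (by exact_mod_cast hne))
      exact_mod_cast this
    have h2 : w n x ≤ |w n x * ((e (n + 1) x : ℝ) - e (n + 1) y)| := by
      rw [abs_mul, abs_of_pos (hw n x)]
      exact le_mul_of_one_le_right (hw n x).le h1
    have h3 : ε n / (n + 2) ≤ w n x / 2 := by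
      exact div_le_div₀ (hw n x).le (hεw n x) two_pos (by simp)
    have h4 := abs_sub_abs_le_abs_sub (w n x * ((e (n + 1) x : ℝ) - e (n + 1) y))
      ((∑' m, a m x) - ∑' m, a m y)
    rw [abs_sub_comm (w n x * _)] at h4
    change w n x / 2 ≤ |(∑' m, a m x) - ∑' m, a m y|
    linarith [hmain n x y h]
  · have h1 : |(e (n + 1) x' : ℝ) - e (n + 1) y'| ≤ k n + 1 := by
      have hx : (e (n + 1) x' : ℝ) ≤ k n := by exact_mod_cast hk n x'
      have hy : (e (n + 1) y' : ℝ) ≤ k n := by exact_mod_cast hk n y'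
      have hx0 : (0 : ℝ) ≤ e (n + 1) x' := Nat.cast_nonneg _
      have hy0 : (0 : ℝ) ≤ e (n + 1) y' := Nat.cast_nonneg _
      rw [abs_le]
      constructor <;> linarith
    have hwx : w n x = w n x' * D n := by rw [hwdef, hwdef, hrx]; ring
    have h2 : |w n x' * ((e (n + 1) x' : ℝ) - e (n + 1) y')| ≤ 1 / (n + 1) * w n x := by
      rw [abs_mul, abs_of_pos (hw n x'), hwx]
      calc _ ≤ w n x' * (k n + 1) := by
            have := (hw n x').le
            gcongr
        _ = _ := by rw [hDdef]; field_simp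
    have h3 : ε n / (n + 2) ≤ 1 / (n + 1) * w n x := by
      rw [one_div_mul_eq_div]
      exact div_le_div₀ (hw n x).le (hεw n x) (by positivity) (by linarith)
    have h4 := abs_sub_abs_le_abs_sub ((∑' m, a m x') - ∑' m, a m y')
      (w n x' * ((e (n + 1) x' : ℝ) - e (n + 1) y'))
    have h5 : 2 / ((n : ℝ) + 1) * w n x = 1 / (n + 1) * w n x + 1 / (n + 1) * w n x := by ring
    rw [h5]
    change |(∑' m, a m x') - ∑' m, a m y'| ≤ _
    linarith [hmain n x' y' h]

theorem exists_eq_and_succ_ne {e : ℕ → C → ℕ} (h0 : ∀ x, e 0 x = 0)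
    (hsep : ∀ x y, x ≠ y → ∃ n, e n x ≠ e n y) {x y : C} (hxy : x ≠ y) :
    ∃ n, e n x = e n y ∧ e (n + 1) x ≠ e (n + 1) y := by
  by_contra! h
  obtain ⟨m, hm⟩ := hsep x y hxy
  refine hm ?_
  clear hm
  induction m with
  | zero => rw [h0, h0]
  | succ n ih => exact h n ih

end Embedding

/-- Every minimal Cantor system `(C, T)` embeds in `ℝ` with vanishing derivative everywhere.
The condition `f (π c) = π (T c)` says that `f = π ∘ T ∘ π⁻¹` on `π(C) = Set.range π`; the derivative
within `π(C)` at a point of `π(C)` only involves these values of `f`. -/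
theorem mainTheorem1 {C : Type*} [MetricSpace C] [CompactSpace C] [TotallyDisconnectedSpace C]
    [PerfectSpace C] (T : C → C) (hT : IsMinimalSystem T) :
    ∃ π : C → ℝ, Topology.IsEmbedding π ∧
      ∃ f : ℝ → ℝ, (∀ c : C, f (π c) = π (T c)) ∧
        ∀ x ∈ Set.range π, HasDerivWithinAt f 0 (Set.range π) x := by
  cases isEmpty_or_nonempty C with
  | inl h =>
    exact ⟨fun _ => 0, .of_subsingleton _, 0, fun c => h.elim c, by
      rintro _ ⟨c, rfl⟩
      exact h.elim c⟩
  | inr h =>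
  -- A finite Hausdorff space is discrete, so its points are isolated.
  have : Infinite C := by
    by_contra hfin
    rw [not_infinite_iff_finite] at hfin
    obtain ⟨x⟩ := h
    exact (PerfectSpace.not_isolated x).ne (discreteTopology_iff_nhds_ne.1 inferInstance x)
  obtain ⟨e, r, he, hr, h0, hmono, her, hsep, hstep⟩ := hT.exists_codes
  obtain ⟨π, w, hπ, hw, hlow, hup⟩ := exists_continuous_of_codes he hr hmono her
  have hinj : Function.Injective π := by
    intro x y hxy
    by_contra hne
    obtain ⟨n, hn, hn'⟩ := exists_eq_and_succ_ne h0 hsep hne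
    have := hlow n x y hn hn'
    rw [hxy, sub_self, abs_zero] at this
    linarith [hw n x]
  have hemb : IsEmbedding π := (hπ.isClosedEmbedding hinj).isEmbedding
  have hf : ∀ c, Function.extend π (π ∘ T) 0 (π c) = π (T c) := fun c => hinj.extend_apply _ _ c
  refine ⟨π, hemb, _, hf, ?_⟩
  rintro _ ⟨x, rfl⟩
  rw [hasDerivWithinAt_iff_isLittleO, ← hemb.map_nhds_eq, Asymptotics.isLittleO_map,
    Asymptotics.isLittleO_iff]
  intro c hc
  have hlim : ∀ᶠ n : ℕ in atTop, 4 * (1 / ((n : ℝ) + 1)) < c := by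
    have := (tendsto_one_div_add_atTop_nhds_zero_nat (𝕜 := ℝ)).const_mul 4
    rw [mul_zero] at this
    exact this.eventually_lt_const hc
  obtain ⟨N, hN⟩ := eventually_atTop.1 ((hstep x).and hlim)
  filter_upwards [(he N).eventually_eq x] with y hy
  simp only [Function.comp_apply, hf, smul_zero, sub_zero, Real.norm_eq_abs]
  rcases eq_or_ne x y with rfl | hxy
  · simp
  obtain ⟨n, hn, hn'⟩ := exists_eq_and_succ_ne h0 hsep hxy
  -- Since `y` shares the level-`N` code of `x`, the codes split only later.
  have hNn : N ≤ n := by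
    by_contra! hlt
    exact hn' (eq_of_eq_of_le hmono hlt hy.symm)
  obtain ⟨⟨hrx, hTe⟩, hcn⟩ := hN n hNn
  have h1 := hup n x (T x) (T y) hrx (hTe y hn)
  have h2 := hlow n x y hn hn'
  rw [abs_sub_comm (π (T y)), abs_sub_comm (π y)]
  calc |π (T x) - π (T y)| ≤ 2 / (n + 1) * w n x := h1
    _ = 4 * (1 / ((n : ℝ) + 1)) * (w n x / 2) := by ring
    _ ≤ c * |π x - π y| := by
      have := hw n x
      gcongr
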